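/- Let $p,q\ge 1$ and let $\mathbf X=(X_1,\dots,X_p)$ and $\mathbf Y=(Y_1,\dots,Y_q)$ be random vectors on a common probability space $(\Omega,\mathcal A,P)$ such that no $Y_i$ has a one-point distribution. For a non-degenerate real random variable $V$ and a random vector $\mathbf Z$ put $$\xi(V|\mathbf Z):=\frac{\int_{\mathbb R}\mathrm{Var}\big(P(V\ge y\mid \mathbf Z)\big)\,\mathrm dP^{V}(y)}{\int_{\mathbb R}\mathrm{Var}\big(\mathbf 1_{\{V\ge y\}}\big)\,\mathrm dP^{V}(y)},$$ where $P^V$ is the law of $V$, and define $$T(\mathbf Y|\mathbf X):=\frac{\sum_{i=1}^q\big[\xi(Y_i|(\mathbf X,Y_{i-1},\dots,Y_1))-\xi(Y_i|(Y_{i-1},\dots,Y_1))\big]}{\sum_{i=1}^q\big[1-\xi(Y_i|(Y_{i-1},\dots,Y_1))\big]},\qquad \xi(Y_1|\emptyset):=0 .$$ Suppose that $(\mathbf X,\mathbf Y)$ is multivariate normal (with arbitrary mean and possibly singular covariance matrix) with covariance matrix $$\Sigma=\begin{pmatrix}\Sigma_{11}&\Sigma_{12}\\ \Sigma_{21}&\Sigma_{22}\end{pmatrix},$$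 where $\Sigma_{11}$ is the $p\times p$ covariance matrix of $\mathbf X$ and $\Sigma_{12}$ is the $p\times q$ matrix of the covariances $\mathrm{Cov}(X_i,Y_j)$. Then (i) $T(\mathbf Y|\mathbf X)=0$ if and only if $\Sigma_{12}$ is the null matrix; (ii) $T(\mathbf Y|\mathbf X)=1$ if and only if $\operatorname{rank}(\Sigma)=\operatorname{rank}(\Sigma_{11})$. -/

import Mathlib

open MeasureTheory ProbabilityTheory

noncomputable section

/-- Azadkia and Chatterjee's rank correlation
`ξ(V | Z) = (∫ Var(P(V ≥ y | Z)) dP^V(y)) / (∫ Var(1_{V ≥ y}) dP^V(y))`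
of a real random variable `V` given a random vector `Z`; here `P(V ≥ y | Z)` is the conditional
probability of the event `{V ≥ y}` given the σ-algebra generated by `Z`. -/
def chatterjeeXi {Ω E : Type*} [mΩ : MeasurableSpace Ω] [mE : MeasurableSpace E]
    (P : Measure Ω) (V : Ω → ℝ) (Z : Ω → E) : ℝ :=
  (∫ y, Var[P[{ω | y ≤ V ω}.indicator (fun _ => (1 : ℝ)) | mE.comap Z]; P] ∂(P.map V)) /
    (∫ y, Var[{ω | y ≤ V ω}.indicator (fun _ => (1 : ℝ)); P] ∂(P.map V))

/-- `ξ(Y_i | (Y_{i-1}, …, Y_1))`, with the convention `ξ(Y_1 | ∅) = 0`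
(components are indexed from `0` here). -/
def xiPast {Ω : Type*} [MeasurableSpace Ω] {q : ℕ}
    (P : Measure Ω) (Y : Ω → Fin q → ℝ) (i : Fin q) : ℝ :=
  if i.val = 0 then 0
  else chatterjeeXi P (fun ω => Y ω i) (fun ω (j : Set.Iio i) => Y ω j)

/-- `ξ(Y_i | (X, Y_{i-1}, …, Y_1))`. -/
def xiJoint {Ω : Type*} [MeasurableSpace Ω] {p q : ℕ}
    (P : Measure Ω) (X : Ω → Fin p → ℝ) (Y : Ω → Fin q → ℝ) (i : Fin q) : ℝ :=
  chatterjeeXi P (fun ω => Y ω i) (fun ω => (X ω, fun j : Set.Iio i => Y ω j))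

/-- The measure of predictability `T(Y | X)` of a response vector `Y` given a predictor
vector `X`. -/
def predictabilityT {Ω : Type*} [MeasurableSpace Ω] {p q : ℕ}
    (P : Measure Ω) (X : Ω → Fin p → ℝ) (Y : Ω → Fin q → ℝ) : ℝ :=
  (∑ i, (xiJoint P X Y i - xiPast P Y i)) / (∑ i, (1 - xiPast P Y i))

/-- The covariance matrix `(Cov(W_i, W_j))_{i,j}` of a random vector `W`. -/
def covarianceMatrix {Ω ι : Type*} [MeasurableSpace Ω]
    (P : Measure Ω) (W : Ω → ι → ℝ) : Matrix ι ι ℝ :=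
  Matrix.of fun i j => cov[fun ω => W ω i, fun ω => W ω j; P]

end

/-! Enlarging the conditioning σ-algebra raises Var(P(V ≥ y | ·)) by exactly the mean squared
difference of the two conditional probabilities. So T = 0 forces P(Y_i ≥ y | ·) to be the same given
the past of Y_i with or without X, and T = 1 forces it to be the indicator itself given X and the
past, each time for P^{Y_i}-almost every y. A nondegenerate Gaussian law dominates Lebesgue measure,
so Lebesgue-almost every y is reached, which suffices to identify conditional means
(`condExp_eq_of_ae_condExp_upperIndicator_eq`).

Gaussianity and strong induction on i do the rest. If T = 0, X is uncorrelated with the past of Y_i,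
hence independent of it, and E[X_k Y_i] = E[X_k E[Y_i | past]] factorizes. If T = 1, the past is
affine in X, so Y_i is a function of X; its regression residual is both independent of X and a
function of X, hence constant. Thus T = 1 means that every Y_i is a.s. affine in X, which is the
rank condition. The converses use that X is independent of Y, respectively that Y_i is a.s.
measurable in X. -/

theorem variance_condExp_eq_add {Ω : Type*} {m m' mΩ : MeasurableSpace Ω} {P : Measure Ω}
    [IsProbabilityMeasure P] (hm : m ≤ m') (hm' : m' ≤ mΩ) {f : Ω → ℝ} (hf : MemLp f 2 P) :
    Var[P[f | m']; P] = Var[P[f | m]; P] + ∫ ω, (P[f | m'] - P[f | m]) ω ^ 2 ∂P := by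
  have hle := hm.trans hm'
  have hg : MemLp (P[f | m']) 2 P := (hf.condExp one_le_two)
  have htower : P[P[f | m'] | m] =ᵐ[P] P[f | m] := condExp_condExp_of_le hm hm'
  -- Law of total variance for `P[f | m']` given `m`; by the tower property its conditional mean is
  -- `P[f | m]`.
  have h := integral_condVar_add_variance_condExp hle hg
  rw [variance_congr htower, condVar, integral_condExp hle] at h
  rw [← h, add_comm]
  congr 1
  refine integral_congr_ae ?_
  filter_upwards [htower] with ω hω
  simp [hω]

theorem variance_condExp_mono {Ω : Type*} {m m' mΩ : MeasurableSpace Ω} {P : Measure Ω}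
    [IsProbabilityMeasure P] (hm : m ≤ m') (hm' : m' ≤ mΩ) {f : Ω → ℝ} (hf : MemLp f 2 P) :
    Var[P[f | m]; P] ≤ Var[P[f | m']; P] := by
  rw [variance_condExp_eq_add hm hm' hf]
  linarith [integral_nonneg (μ := P) (f := fun ω => (P[f | m'] - P[f | m]) ω ^ 2)
    fun ω => sq_nonneg _]

theorem condExp_ae_eq_of_variance_eq {Ω : Type*} {m m' mΩ : MeasurableSpace Ω} {P : Measure Ω}
    [IsProbabilityMeasure P] (hm : m ≤ m') (hm' : m' ≤ mΩ) {f : Ω → ℝ} (hf : MemLp f 2 P)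
    (h : Var[P[f | m]; P] = Var[P[f | m']; P]) : P[f | m] =ᵐ[P] P[f | m'] := by
  have h0 : ∫ ω, (P[f | m'] - P[f | m]) ω ^ 2 ∂P = 0 := by
    linarith [variance_condExp_eq_add hm hm' hf]
  rw [integral_eq_zero_iff_of_nonneg (fun ω => sq_nonneg _)
    ((hf.condExp one_le_two).sub (hf.condExp one_le_two)).integrable_sq] at h0
  filter_upwards [h0] with ω hω
  have : (P[f | m'] ω - P[f | m] ω) ^ 2 = 0 := hω
  have := pow_eq_zero_iff (two_ne_zero) |>.1 this
  linarith

/-! ### Integrated variances and their monotonicity in the σ-algebra -/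

/-- The indicator of the event `{V ≥ y}`. -/
noncomputable abbrev upperIndicator {Ω : Type*} (V : Ω → ℝ) (y : ℝ) : Ω → ℝ :=
  {ω | y ≤ V ω}.indicator (fun _ => (1 : ℝ))

/-- The integrated variance `∫ Var(P(V ≥ y | m)) dP^V(y)`. -/
noncomputable def integratedVariance {Ω : Type*} (m : MeasurableSpace Ω) {mΩ : MeasurableSpace Ω}
    (P : Measure Ω) (V : Ω → ℝ) : ℝ :=
  ∫ y, Var[P[upperIndicator V y | m]; P] ∂(P.map V)

section
variable {Ω : Type*} {m m' mΩ : MeasurableSpace Ω} {P : Measure Ω} {V : Ω → ℝ}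

theorem measurable_upperIndicator (hV : Measurable V) (y : ℝ) :
    Measurable (upperIndicator V y) :=
  measurable_const.indicator (measurableSet_le measurable_const hV)

theorem memLp_upperIndicator [IsProbabilityMeasure P] (hV : Measurable V) (y : ℝ) :
    MemLp (upperIndicator V y) 2 P :=
  (memLp_const 1).indicator (measurableSet_le measurable_const hV)

theorem upperIndicator_nonneg (y : ℝ) : 0 ≤ upperIndicator V y :=
  fun _ => Set.indicator_nonneg (fun _ _ => zero_le_one) _

theorem upperIndicator_le_one (y : ℝ) (ω : Ω) : upperIndicator V y ω ≤ 1 :=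
  Set.indicator_le_self' (fun _ _ => zero_le_one) _

theorem upperIndicator_antitone (ω : Ω) : Antitone fun y => upperIndicator V y ω :=
  fun _ _ h => Set.indicator_le_indicator_of_subset (fun _ hω => le_trans h hω)
    (fun _ => zero_le_one) ω

/-- The variance is a second moment minus a squared mean, and both moments are antitone in y. -/
theorem measurable_variance_condExp_upperIndicator [IsProbabilityMeasure P] (hm : m ≤ mΩ)
    (hV : Measurable V) : Measurable fun y => Var[P[upperIndicator V y | m]; P] := by
  have hint (y : ℝ) : Integrable (upperIndicator V y) P :=
    (memLp_upperIndicator hV y).integrable one_le_two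
  have h1 : Antitone fun y => ∫ ω, (P[upperIndicator V y | m]) ω ^ 2 ∂P := by
    intro y z hyz
    refine integral_mono_ae ((memLp_upperIndicator hV z).condExp one_le_two).integrable_sq
      ((memLp_upperIndicator hV y).condExp one_le_two).integrable_sq ?_
    filter_upwards [condExp_mono (m := m) (hint z) (hint y)
        (.of_forall fun ω => upperIndicator_antitone ω hyz),
      condExp_nonneg (m := m) (μ := P) (.of_forall (upperIndicator_nonneg (V := V) z))] with ω h h'
    exact pow_le_pow_left₀ h' h 2
  have h2 : Antitone fun y => ∫ ω, upperIndicator V y ω ∂P := fun y z hyz =>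
    integral_mono (hint z) (hint y) fun ω => upperIndicator_antitone ω hyz
  convert h1.measurable.sub (h2.measurable.pow_const 2) using 1
  ext y
  rw [variance_eq_sub ((memLp_upperIndicator hV y).condExp one_le_two), integral_condExp hm]
  simp

theorem variance_condExp_upperIndicator_le [IsProbabilityMeasure P] (hm : m ≤ mΩ)
    (hV : Measurable V) (y : ℝ) : Var[P[upperIndicator V y | m]; P] ≤ 1 := by
  have hf := memLp_upperIndicator (P := P) hV y
  refine (variance_condExp_mono hm le_rfl hf).trans ?_
  rw [condExp_of_stronglyMeasurable le_rfl (measurable_upperIndicator hV y).stronglyMeasurable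
    (hf.integrable one_le_two)]
  refine (variance_le_expectation_sq hf.1).trans ?_
  calc _ ≤ ∫ _, (1 : ℝ) ∂P := integral_mono hf.integrable_sq (integrable_const _) fun ω =>
        pow_le_one₀ (upperIndicator_nonneg y ω) (upperIndicator_le_one y ω)
    _ = 1 := by simp

theorem integrable_variance_condExp_upperIndicator [IsProbabilityMeasure P] (hm : m ≤ mΩ)
    (hV : Measurable V) :
    Integrable (fun y => Var[P[upperIndicator V y | m]; P]) (P.map V) := by
  have := Measure.isProbabilityMeasure_map (μ := P) hV.aemeasurable
  refine Integrable.of_bound (measurable_variance_condExp_upperIndicator hm hV).aestronglyMeasurable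
    1 (.of_forall fun y => ?_)
  rw [Real.norm_of_nonneg (variance_nonneg _ _)]
  exact variance_condExp_upperIndicator_le hm hV y

theorem integratedVariance_mono [IsProbabilityMeasure P] (hm : m ≤ m') (hm' : m' ≤ mΩ)
    (hV : Measurable V) : integratedVariance m P V ≤ integratedVariance m' P V :=
  integral_mono (integrable_variance_condExp_upperIndicator (hm.trans hm') hV)
    (integrable_variance_condExp_upperIndicator hm' hV) fun y =>
      variance_condExp_mono hm hm' (memLp_upperIndicator hV y)

theorem ae_condExp_eq_of_integratedVariance_eq [IsProbabilityMeasure P] (hm : m ≤ m')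
    (hm' : m' ≤ mΩ) (hV : Measurable V)
    (h : integratedVariance m P V = integratedVariance m' P V) :
    ∀ᵐ y ∂(P.map V), P[upperIndicator V y | m] =ᵐ[P] P[upperIndicator V y | m'] := by
  have hae := (integral_eq_iff_of_ae_le
    (integrable_variance_condExp_upperIndicator (hm.trans hm') hV)
    (integrable_variance_condExp_upperIndicator hm' hV)
    (.of_forall fun y => variance_condExp_mono hm hm' (memLp_upperIndicator hV y))).1 h
  filter_upwards [hae] with y hy
  exact condExp_ae_eq_of_variance_eq hm hm' (memLp_upperIndicator hV y) hy

theorem integratedVariance_congr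
    (h : ∀ y, P[upperIndicator V y | m] =ᵐ[P] P[upperIndicator V y | m']) :
    integratedVariance m P V = integratedVariance m' P V := by
  unfold integratedVariance
  simp_rw [fun y => variance_congr (h y)]

/-! ### From conditional tail probabilities to conditional means -/

/-- Finite measures on the line that agree on almost all closed upper half-lines are equal. -/
theorem measure_ext_of_ae_Ici {μ ν : Measure ℝ} [IsFiniteMeasure μ] [IsFiniteMeasure ν]
    (h : ∀ᵐ y, μ (Set.Ici y) = ν (Set.Ici y)) : μ = ν := by
  have hd : Dense {y : ℝ | μ (Set.Ici y) = ν (Set.Ici y)} := Measure.dense_of_ae h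
  refine Measure.ext_of_Ici _ _ fun a => ?_
  -- Good points increase strictly to a, so their closed half-lines decrease to `Set.Ici a` and
  -- continuity from above applies.
  obtain ⟨u, humono, hu, hlim⟩ := hd.exists_seq_strictMono_tendsto a
  have hinter : Set.Ici a = ⋂ n, Set.Ici (u n) := by
    ext x
    simp only [Set.mem_Ici, Set.mem_iInter]
    exact ⟨fun hx n => ((hu n).1.le).trans hx, fun hx => le_of_tendsto' hlim hx⟩
  have hanti : Antitone fun n => Set.Ici (u n) := fun i j hij =>
    Set.Ici_subset_Ici.2 (humono.monotone hij)
  rw [hinter]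
  refine tendsto_nhds_unique (tendsto_measure_iInter_atTop
    (fun n => measurableSet_Ici.nullMeasurableSet) hanti ⟨0, measure_ne_top _ _⟩) ?_
  have heq : μ ∘ (fun n => Set.Ici (u n)) = ν ∘ fun n => Set.Ici (u n) := funext fun n => (hu n).2
  rw [heq]
  exact tendsto_measure_iInter_atTop
    (fun n => measurableSet_Ici.nullMeasurableSet) hanti ⟨0, measure_ne_top _ _⟩

/-- For s in `m'` and g = P(s | m), the hypothesis says that V has the same law under P restricted
to s as under g·P, since the two laws agree on almost all half-lines. Comparing means gives the
integral identity on s. This avoids integrating conditional probabilities over y. -/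
theorem condExp_eq_of_ae_condExp_upperIndicator_eq [IsProbabilityMeasure P] (hm : m ≤ m')
    (hm' : m' ≤ mΩ) (hV : Measurable V) (hVint : Integrable V P)
    (h : ∀ᵐ y, P[upperIndicator V y | m] =ᵐ[P] P[upperIndicator V y | m']) :
    P[V | m] =ᵐ[P] P[V | m'] := by
  have hle := hm.trans hm'
  refine ae_eq_condExp_of_forall_setIntegral_eq hm' hVint
    (fun s _ _ => integrable_condExp.integrableOn) (fun s hs _ => ?_)
    (stronglyMeasurable_condExp.mono hm).aestronglyMeasurable
  have hs' : MeasurableSet s := hm' s hs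
  set f : Ω → ℝ := s.indicator fun _ => 1 with hf
  have hfint : Integrable f P := (integrable_const 1).indicator hs'
  set g : Ω → ℝ := P[f | m] with hg
  have hgm : StronglyMeasurable[m] g := stronglyMeasurable_condExp
  have hgmeas : Measurable g := (hgm.mono hle).measurable
  have hg0 : 0 ≤ᵐ[P] g := condExp_nonneg (.of_forall fun ω =>
    Set.indicator_nonneg (fun _ _ => zero_le_one) ω)
  have hg1 : ∀ᵐ ω ∂P, ‖g ω‖ ≤ 1 := by
    have : g ≤ᵐ[P] P[fun _ => (1 : ℝ) | m] := condExp_mono hfint (integrable_const 1)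
      (.of_forall fun ω => Set.indicator_le_self' (fun _ _ => zero_le_one) ω)
    rw [condExp_const hle] at this
    filter_upwards [hg0, this] with ω h0 h1
    rw [Real.norm_of_nonneg h0]
    exact h1
  -- Conditional expectation is self-adjoint: the conditioning moves from W to the indicator of s.
  have hfg {W : Ω → ℝ} (hW : Integrable W P) :
      ∫ ω in s, P[W | m] ω ∂P = ∫ ω, g ω * W ω ∂P := by
    have e1 : ∫ ω in s, P[W | m] ω ∂P = ∫ ω, (f * P[W | m]) ω ∂P := by
      rw [← integral_indicator hs']
      congr 1 with ω
      by_cases hω : ω ∈ s <;> simp [hf, hω]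
    have hbd : Integrable (f * P[W | m]) P := by
      refine integrable_condExp.bdd_mul (c := 1) hfint.1 (.of_forall fun ω => ?_)
      by_cases hω : ω ∈ s <;> simp [hf, hω]
    have hgW : Integrable (g * W) P := hW.bdd_mul hgmeas.aestronglyMeasurable hg1
    rw [e1, ← integral_condExp hle, integral_congr_ae
      (condExp_mul_of_stronglyMeasurable_right stronglyMeasurable_condExp hbd hfint)]
    change _ = ∫ ω, (g * W) ω ∂P
    rw [← integral_condExp hle (f := g * W), integral_congr_ae
      (condExp_mul_of_stronglyMeasurable_left hgm hgW hW)]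
  rw [hfg hVint]
  set Q : Measure Ω := P.withDensity fun ω => ENNReal.ofReal (g ω) with hQ
  have hgint : Integrable g P := integrable_condExp
  have : IsFiniteMeasure Q := isFiniteMeasure_withDensity_ofReal hgint.2
  have hQapp {A : Set Ω} (hA : MeasurableSet A) : Q A = ENNReal.ofReal (∫ ω in A, g ω ∂P) := by
    rw [hQ, withDensity_apply _ hA, ofReal_integral_eq_lintegral_ofReal hgint.integrableOn
      (ae_restrict_of_ae hg0)]
  have hmap : (P.restrict s).map V = Q.map V := by
    refine measure_ext_of_ae_Ici ?_
    filter_upwards [h] with y hy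
    have hA : MeasurableSet {ω | y ≤ V ω} := measurableSet_le measurable_const hV
    have hi : Integrable (upperIndicator V y) P :=
      (memLp_upperIndicator hV y).integrable one_le_two
    rw [Measure.map_apply hV measurableSet_Ici, Measure.map_apply hV measurableSet_Ici]
    change P.restrict s {ω | y ≤ V ω} = Q {ω | y ≤ V ω}
    have e : ∫ ω in {ω | y ≤ V ω}, g ω ∂P = P.real ({ω | y ≤ V ω} ∩ s) := by
      calc ∫ ω in {ω | y ≤ V ω}, g ω ∂P = ∫ ω, g ω * upperIndicator V y ω ∂P := by
            rw [← integral_indicator hA]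
            congr 1 with ω
            by_cases hω : y ≤ V ω <;> simp [upperIndicator, hω]
        _ = ∫ ω in s, P[upperIndicator V y | m'] ω ∂P := by
            rw [← hfg hi]
            exact integral_congr_ae (ae_restrict_of_ae hy)
        _ = ∫ ω in s, upperIndicator V y ω ∂P := setIntegral_condExp hm' hi hs
        _ = P.real ({ω | y ≤ V ω} ∩ s) := by
            rw [upperIndicator, integral_indicator_const _ hA]
            simp [measureReal_restrict_apply hA]
    rw [hQapp hA, e, Measure.restrict_apply hA, ofReal_measureReal]
  calc ∫ ω, g ω * V ω ∂P = ∫ ω, V ω ∂Q := by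
        rw [hQ, integral_withDensity_eq_integral_toReal_smul hgmeas.ennreal_ofReal (by simp)]
        refine integral_congr_ae ?_
        filter_upwards [hg0] with ω hω
        rw [ENNReal.toReal_ofReal hω, smul_eq_mul]
    _ = ∫ x, x ∂(Q.map V) := (integral_map hV.aemeasurable aestronglyMeasurable_id).symm
    _ = ∫ ω in s, V ω ∂P := by
        rw [← hmap]
        exact integral_map hV.aemeasurable aestronglyMeasurable_id

end

/-! ### Conditioning on an additional independent σ-algebra -/

theorem MeasurableSpace.sup_eq_generateFrom_inter {Ω : Type*} (m₁ m₂ : MeasurableSpace Ω) :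
    m₁ ⊔ m₂ = MeasurableSpace.generateFrom
      {s | ∃ A B, MeasurableSet[m₁] A ∧ MeasurableSet[m₂] B ∧ A ∩ B = s} := by
  refine le_antisymm (sup_le (fun A hA => ?_) (fun B hB => ?_))
    (MeasurableSpace.generateFrom_le ?_)
  · exact MeasurableSpace.measurableSet_generateFrom
      ⟨A, Set.univ, hA, MeasurableSet.univ, Set.inter_univ A⟩
  · exact MeasurableSpace.measurableSet_generateFrom
      ⟨Set.univ, B, MeasurableSet.univ, hB, Set.univ_inter B⟩
  · rintro _ ⟨A, B, hA, hB, rfl⟩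
    exact MeasurableSet.inter ((le_sup_left : m₁ ≤ m₁ ⊔ m₂) A hA)
      ((le_sup_right : m₂ ≤ m₁ ⊔ m₂) B hB)

theorem setIntegral_inter_of_indep {Ω : Type*} {m₂ m₃ mΩ : MeasurableSpace Ω} {P : Measure Ω}
    [IsProbabilityMeasure P] (h₂ : m₂ ≤ mΩ) (h₃ : m₃ ≤ mΩ) (hindep : Indep m₂ m₃ P) {h : Ω → ℝ}
    (hh : StronglyMeasurable[m₃] h) {A B : Set Ω} (hA : MeasurableSet[m₂] A)
    (hB : MeasurableSet[m₃] B) :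
    ∫ ω in A ∩ B, h ω ∂P = P.real A * ∫ ω in B, h ω ∂P := by
  have hf : Measurable[m₂] (A.indicator fun _ => (1 : ℝ)) :=
    (@measurable_const _ _ _ m₂ (1 : ℝ)).indicator hA
  have hg : StronglyMeasurable[m₃] (B.indicator h) := hh.indicator hB
  have hI : IndepFun (A.indicator fun _ => (1 : ℝ)) (B.indicator h) P := by
    rw [IndepFun_iff_Indep]
    exact indep_of_indep_of_le_left (indep_of_indep_of_le_right hindep
      hg.measurable.comap_le) hf.comap_le
  have := hI.integral_fun_mul_eq_mul_integral (hf.mono h₂ le_rfl).aestronglyMeasurable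
    (hg.mono h₃).aestronglyMeasurable
  rw [integral_indicator_const _ (h₂ _ hA), integral_indicator (h₃ _ hB)] at this
  rw [← integral_indicator ((h₂ _ hA).inter (h₃ _ hB))]
  simp only [smul_eq_mul, mul_one] at this
  rw [← this]
  congr 1 with ω
  by_cases h1 : ω ∈ A <;> by_cases h2 : ω ∈ B <;> simp [h1, h2]

/-- Enlarging the conditioning σ-algebra by an independent one does not change the conditional
expectation. -/
theorem condExp_sup_of_indep {Ω : Type*} {m₁ m₂ m₃ mΩ : MeasurableSpace Ω} {P : Measure Ω}
    [IsProbabilityMeasure P] (h₁₃ : m₁ ≤ m₃) (h₂ : m₂ ≤ mΩ) (h₃ : m₃ ≤ mΩ)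
    (hindep : Indep m₂ m₃ P) {f : Ω → ℝ} (hf : StronglyMeasurable[m₃] f) (hfint : Integrable f P) :
    P[f | m₁] =ᵐ[P] P[f | m₂ ⊔ m₁] := by
  have h₁ : m₁ ≤ mΩ := h₁₃.trans h₃
  have hle : m₂ ⊔ m₁ ≤ mΩ := sup_le h₂ h₁
  refine ae_eq_condExp_of_forall_setIntegral_eq hle hfint
    (fun s _ _ => integrable_condExp.integrableOn) (fun s hs _ => ?_)
    (stronglyMeasurable_condExp.mono (le_sup_right : m₁ ≤ m₂ ⊔ m₁)).aestronglyMeasurable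
  have hpi : IsPiSystem {s | ∃ A B, MeasurableSet[m₂] A ∧ MeasurableSet[m₁] B ∧ A ∩ B = s} := by
    rintro _ ⟨A, B, hA, hB, rfl⟩ _ ⟨A', B', hA', hB', rfl⟩ -
    exact ⟨A ∩ A', B ∩ B', hA.inter hA', hB.inter hB', (Set.inter_inter_inter_comm ..).symm⟩
  induction s, hs using MeasurableSpace.induction_on_inter
    (MeasurableSpace.sup_eq_generateFrom_inter m₂ m₁) hpi with
  | empty => simp
  | basic s hs =>
    obtain ⟨A, B, hA, hB, rfl⟩ := hs
    -- Both f and `P[f | m₁]` are `m₃`-measurable, so independence pulls the factor P(A) out of both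
    -- sides.
    rw [setIntegral_inter_of_indep h₂ h₃ hindep (stronglyMeasurable_condExp.mono h₁₃) hA
      (h₁₃ _ hB), setIntegral_inter_of_indep h₂ h₃ hindep hf hA (h₁₃ _ hB),
      setIntegral_condExp h₁ hfint hB]
  | compl s hs ih =>
    have e1 := integral_add_compl (hle _ hs) hfint
    have e2 := integral_add_compl (hle _ hs) (integrable_condExp (m := m₁) (f := f) (μ := P))
    rw [integral_condExp h₁] at e2
    have := ih (measure_lt_top _ _)
    linarith
  | iUnion s hd hs ih =>
    rw [integral_iUnion (fun i => hle _ (hs i)) hd integrable_condExp.integrableOn,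
      integral_iUnion (fun i => hle _ (hs i)) hd hfint.integrableOn]
    exact tsum_congr fun i => ih i (measure_lt_top _ _)

/-! ### ξ as a quotient of integrated variances -/

section
variable {Ω E : Type*} {m mΩ : MeasurableSpace Ω} {mE : MeasurableSpace E} {P : Measure Ω}
  {V : Ω → ℝ}

theorem condExp_upperIndicator_self [IsProbabilityMeasure P] (hV : Measurable V) (y : ℝ) :
    P[upperIndicator V y | mΩ] = upperIndicator V y :=
  condExp_of_stronglyMeasurable le_rfl (measurable_upperIndicator hV y).stronglyMeasurable
    ((memLp_upperIndicator hV y).integrable one_le_two)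

theorem chatterjeeXi_eq_div [IsProbabilityMeasure P] (hV : Measurable V) (Z : Ω → E) :
    chatterjeeXi P V Z = integratedVariance (mE.comap Z) P V / integratedVariance mΩ P V := by
  unfold chatterjeeXi integratedVariance
  simp_rw [condExp_upperIndicator_self hV]

/-- This makes the convention ξ(Y_1 | ∅) = 0 an instance of the general quotient, with trivial
conditioning. -/
theorem integratedVariance_bot [IsProbabilityMeasure P] : integratedVariance ⊥ P V = 0 := by
  unfold integratedVariance
  have (y : ℝ) : Var[P[upperIndicator V y | (⊥ : MeasurableSpace Ω)]; P] = 0 := by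
    rw [condExp_bot]
    rw [← covariance_self aemeasurable_const, covariance_const_left]
  exact (integral_congr_ae (.of_forall this)).trans (by simp)

/-- If it vanished, it would equal the value for the trivial σ-algebra, so V would a.s. equal its
mean. -/
theorem integratedVariance_pos [IsProbabilityMeasure P] (hV : Measurable V)
    (hVint : Integrable V P) (hvol : volume ≪ P.map V) (hnd : ∀ c, P.map V ≠ Measure.dirac c) :
    0 < integratedVariance mΩ P V := by
  refine lt_of_le_of_ne (integral_nonneg fun y => variance_nonneg _ _) fun h => ?_
  have h1 : P[V | ⊥] =ᵐ[P] P[V | mΩ] :=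
    condExp_eq_of_ae_condExp_upperIndicator_eq bot_le le_rfl hV hVint <|
      hvol.ae_le <| ae_condExp_eq_of_integratedVariance_eq bot_le le_rfl hV <| by
        rw [integratedVariance_bot, h]
  rw [condExp_bot, condExp_of_stronglyMeasurable le_rfl hV.stronglyMeasurable hVint] at h1
  refine hnd (∫ ω, V ω ∂P) ?_
  rw [← Measure.map_congr h1, Measure.map_const]
  simp

theorem integratedVariance_eq_of_ae_eq [IsProbabilityMeasure P] (hm : m ≤ mΩ) (hV : Measurable V)
    {V' : Ω → ℝ} (hV' : Measurable[m] V') (h : V =ᵐ[P] V') :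
    integratedVariance m P V = integratedVariance mΩ P V := by
  refine integratedVariance_congr fun y => ?_
  have hind : upperIndicator V y =ᵐ[P] upperIndicator V' y := by
    filter_upwards [h] with ω hω
    simp [upperIndicator, Set.indicator, hω]
  have hV'' := hV'.mono hm le_rfl
  rw [condExp_upperIndicator_self hV]
  refine (condExp_congr_ae hind).trans ?_
  rw [condExp_of_stronglyMeasurable hm (@measurable_upperIndicator _ m _ hV' y).stronglyMeasurable
    ((memLp_upperIndicator hV'' y).integrable one_le_two)]
  exact hind.symm

end

/-! ### Extreme values of T -/

section
variable {Ω : Type*} {p q : ℕ} {X : Ω → Fin p → ℝ} {Y : Ω → Fin q → ℝ}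

/-- The σ-algebra generated by `Y_j`, `j < i`. -/
abbrev pastSigma (Y : Ω → Fin q → ℝ) (i : Fin q) : MeasurableSpace Ω :=
  MeasurableSpace.comap (fun ω (j : Set.Iio i) => Y ω j) inferInstance

/-- The σ-algebra generated by `X` and `Y_j`, `j < i`. -/
abbrev jointSigma (X : Ω → Fin p → ℝ) (Y : Ω → Fin q → ℝ) (i : Fin q) : MeasurableSpace Ω :=
  MeasurableSpace.comap (fun ω => (X ω, fun j : Set.Iio i => Y ω j)) inferInstance

theorem jointSigma_eq_sup (i : Fin q) :
    jointSigma X Y i = MeasurableSpace.comap X inferInstance ⊔ pastSigma Y i :=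
  MeasurableSpace.comap_prodMk _ _

theorem pastSigma_le_jointSigma (i : Fin q) : pastSigma Y i ≤ jointSigma X Y i :=
  le_sup_right.trans (jointSigma_eq_sup i).ge

theorem pastSigma_zero {i : Fin q} (hi : i.val = 0) : pastSigma Y i = ⊥ := by
  have : IsEmpty (Set.Iio i) := ⟨fun j => by
    have : j.1.val < i.val := j.2
    omega⟩
  have h : (fun ω (j : Set.Iio i) => Y ω j) = fun _ => isEmptyElim := by
    ext ω j
    exact isEmptyElim j
  rw [pastSigma, h, MeasurableSpace.comap_const]

variable [mΩ : MeasurableSpace Ω] {P : Measure Ω}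

theorem jointSigma_le (hX : Measurable X) (hY : Measurable Y) (i : Fin q) :
    jointSigma X Y i ≤ mΩ :=
  Measurable.comap_le (by fun_prop)

theorem xiPast_eq_div [IsProbabilityMeasure P] (hY : Measurable Y) (i : Fin q) :
    xiPast P Y i = integratedVariance (pastSigma Y i) P (fun ω => Y ω i) /
      integratedVariance mΩ P (fun ω => Y ω i) := by
  unfold xiPast
  split_ifs with hi
  · rw [pastSigma_zero hi, integratedVariance_bot, zero_div]
  · exact chatterjeeXi_eq_div (by fun_prop) _

theorem xiJoint_eq_div [IsProbabilityMeasure P] (hY : Measurable Y) (i : Fin q) :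
    xiJoint P X Y i = integratedVariance (jointSigma X Y i) P (fun ω => Y ω i) /
      integratedVariance mΩ P (fun ω => Y ω i) :=
  chatterjeeXi_eq_div (by fun_prop) _

variable [IsProbabilityMeasure P]

theorem xiPast_le_xiJoint (hX : Measurable X) (hY : Measurable Y)
    (hpos : ∀ i, 0 < integratedVariance mΩ P (fun ω => Y ω i))
    (i : Fin q) : xiPast P Y i ≤ xiJoint P X Y i := by
  rw [xiPast_eq_div hY, xiJoint_eq_div hY]
  exact div_le_div_of_nonneg_right (integratedVariance_mono (pastSigma_le_jointSigma i)
    (jointSigma_le hX hY i) (by fun_prop)) (hpos i).le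

theorem xiJoint_le_one (hX : Measurable X) (hY : Measurable Y)
    (hpos : ∀ i, 0 < integratedVariance mΩ P (fun ω => Y ω i))
    (i : Fin q) : xiJoint P X Y i ≤ 1 := by
  rw [xiJoint_eq_div hY, div_le_one (hpos i)]
  exact integratedVariance_mono (jointSigma_le hX hY i) le_rfl (by fun_prop)

theorem sum_one_sub_xiPast_pos (hX : Measurable X) (hY : Measurable Y)
    (hpos : ∀ i, 0 < integratedVariance mΩ P (fun ω => Y ω i))
    (hq : 1 ≤ q) : 0 < ∑ i, (1 - xiPast P Y i) := by
  -- The first summand is 1, because ξ(Y_1 | ∅) = 0.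
  refine Finset.sum_pos' (fun i _ => ?_) ⟨⟨0, hq⟩, Finset.mem_univ _, by simp [xiPast]⟩
  linarith [xiPast_le_xiJoint hX hY hpos i, xiJoint_le_one hX hY hpos i]

theorem predictabilityT_eq_zero_iff (hX : Measurable X) (hY : Measurable Y)
    (hpos : ∀ i, 0 < integratedVariance mΩ P (fun ω => Y ω i)) (hq : 1 ≤ q) :
    predictabilityT P X Y = 0 ↔ ∀ i, integratedVariance (pastSigma Y i) P (fun ω => Y ω i) =
      integratedVariance (jointSigma X Y i) P (fun ω => Y ω i) := by
  rw [predictabilityT, div_eq_zero_iff, or_iff_left (sum_one_sub_xiPast_pos hX hY hpos hq).ne',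
    Finset.sum_eq_zero_iff_of_nonneg fun i _ => sub_nonneg.2 (xiPast_le_xiJoint hX hY hpos i)]
  simp only [Finset.mem_univ, true_imp_iff]
  refine forall_congr' fun i => ?_
  rw [sub_eq_zero, xiPast_eq_div hY, xiJoint_eq_div hY, div_left_inj' (hpos i).ne', eq_comm]

/-- Denominator minus numerator is the sum of the nonnegative terms 1 - ξ(Y_i | X, past). -/
theorem predictabilityT_eq_one_iff (hX : Measurable X) (hY : Measurable Y)
    (hpos : ∀ i, 0 < integratedVariance mΩ P (fun ω => Y ω i)) (hq : 1 ≤ q) :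
    predictabilityT P X Y = 1 ↔ ∀ i, integratedVariance (jointSigma X Y i) P (fun ω => Y ω i) =
      integratedVariance mΩ P (fun ω => Y ω i) := by
  rw [predictabilityT, div_eq_one_iff_eq (sum_one_sub_xiPast_pos hX hY hpos hq).ne',
    eq_comm, ← sub_eq_zero, ← Finset.sum_sub_distrib]
  simp only [sub_sub_sub_cancel_right]
  rw [Finset.sum_eq_zero_iff_of_nonneg fun i _ => sub_nonneg.2 (xiJoint_le_one hX hY hpos i)]
  simp only [Finset.mem_univ, true_imp_iff]
  refine forall_congr' fun i => ?_
  rw [sub_eq_zero, xiJoint_eq_div hY, eq_comm, div_eq_one_iff_eq (hpos i).ne']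

end

/-! ### Rank of a symmetric block matrix -/

open scoped Matrix in
-- With T the left block column, rank S₁₁ ≤ rank T ≤ rank S. Equality of ranks makes the column
-- spaces of T and S coincide. Conversely S = T R, and symmetry gives Tᵀ = S₁₁ R, so rank S ≤ rank T
-- ≤ rank S₁₁.
theorem Matrix.rank_eq_rank_toBlocks₁₁_iff {m n : Type*} [Fintype m] [Fintype n]
    {S : Matrix (m ⊕ n) (m ⊕ n) ℝ} (hS : S.IsSymm) :
    S.rank = S.toBlocks₁₁.rank ↔
      ∀ i : n, ∃ a : m → ℝ, ∀ s, S s (Sum.inr i) = ∑ k, S s (Sum.inl k) * a k := by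
  classical
  set T : Matrix (m ⊕ n) m ℝ := S.submatrix id Sum.inl with hT
  have hTS : T.rank ≤ S.rank := S.rank_submatrix_le id Sum.inl
  have h11 : S.toBlocks₁₁.rank ≤ T.rank := T.rank_submatrix_le Sum.inl id
  constructor
  · intro h i
    have hle : LinearMap.range T.mulVecLin ≤ LinearMap.range S.mulVecLin := by
      rintro _ ⟨a, rfl⟩
      refine ⟨Sum.elim a 0, ?_⟩
      ext s
      simp [Matrix.mulVec, dotProduct, hT]
    have heq := Submodule.eq_of_le_of_finrank_eq hle
      (le_antisymm hTS (h.le.trans h11))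
    have hmem : S.mulVecLin (Pi.single (Sum.inr i) 1) ∈ LinearMap.range T.mulVecLin :=
      heq ▸ LinearMap.mem_range_self _ _
    obtain ⟨a, ha⟩ := hmem
    refine ⟨a, fun s => ?_⟩
    have := congrFun ha s
    simp only [Matrix.mulVecLin_apply, Matrix.mulVec_single_one] at this
    exact this.symm
  · intro h
    choose a ha using h
    set R : Matrix m (m ⊕ n) ℝ := Matrix.fromCols 1 (Matrix.of fun k i => a i k) with hR
    have hSR : S = T * R := by
      ext s (k | i)
      · simp [hR, hT, Matrix.mul_apply, Matrix.one_apply]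
      · simp [hR, hT, Matrix.mul_apply, ha]
    have hTR : Tᵀ = S.toBlocks₁₁ * R := by
      have h1 : Tᵀ = S.submatrix Sum.inl id := by
        rw [hT, Matrix.transpose_submatrix, hS.eq]
      rw [h1]
      nth_rw 1 [hSR]
      rfl
    refine le_antisymm ?_ (h11.trans hTS)
    calc S.rank = (T * R).rank := by rw [← hSR]
      _ ≤ T.rank := Matrix.rank_mul_le_left _ _
      _ = (S.toBlocks₁₁ * R).rank := by rw [← hTR, Matrix.rank_transpose]
      _ ≤ S.toBlocks₁₁.rank := Matrix.rank_mul_le_left _ _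

/-! ### Linear regression and Gaussian residuals -/

section
variable {Ω : Type*} [MeasurableSpace Ω] {P : Measure Ω} {p : ℕ} {X : Ω → Fin p → ℝ}

theorem covariance_congr_left {U U' V : Ω → ℝ} (h : U =ᵐ[P] U') : cov[U, V; P] = cov[U', V; P] := by
  unfold covariance
  rw [integral_congr_ae h]
  refine integral_congr_ae ?_
  filter_upwards [h] with ω hω
  rw [hω]

theorem covariance_congr_right {U V V' : Ω → ℝ} (h : V =ᵐ[P] V') :
    cov[U, V; P] = cov[U, V'; P] := by
  rw [covariance_comm, covariance_congr_left h, covariance_comm]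

theorem covariance_eq_zero_of_variance_eq_zero [IsProbabilityMeasure P] {U : Ω → ℝ} (V : Ω → ℝ)
    (hU : MemLp U 2 P) (h : Var[U; P] = 0) : cov[U, V; P] = 0 := by
  rw [covariance_congr_left (ae_eq_integral_of_variance_eq_zero hU h), covariance_const_left]

theorem memLp_sum_mul (hX : ∀ k, MemLp (fun ω => X ω k) 2 P) (a : Fin p → ℝ) :
    MemLp (fun ω => ∑ k, a k * X ω k) 2 P :=
  memLp_finsetSum _ fun k _ => (hX k).const_mul (a k)

theorem covariance_sum_mul_right [IsProbabilityMeasure P] (hX : ∀ k, MemLp (fun ω => X ω k) 2 P)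
    {U : Ω → ℝ} (hU : MemLp U 2 P) (a : Fin p → ℝ) :
    cov[U, fun ω => ∑ k, a k * X ω k; P] = ∑ k, cov[U, fun ω => X ω k; P] * a k := by
  rw [covariance_fun_sum_right (fun k => (hX k).const_mul (a k)) hU]
  exact Finset.sum_congr rfl fun k _ => by rw [covariance_const_mul_right, mul_comm]

/-- The normal equations are solvable, also for a singular covariance matrix. -/
theorem exists_covariance_sub_sum_eq_zero [IsProbabilityMeasure P]
    (hX : ∀ k, MemLp (fun ω => X ω k) 2 P) {V : Ω → ℝ} (hV : MemLp V 2 P) :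
    ∃ a : Fin p → ℝ, ∀ k, cov[fun ω => X ω k, fun ω => V ω - ∑ l, a l * X ω l; P] = 0 := by
  suffices h : (fun k => cov[fun ω => X ω k, V; P]) ∈
      LinearMap.range (covarianceMatrix P X).mulVecLin by
    obtain ⟨a, ha⟩ := h
    refine ⟨a, fun k => ?_⟩
    rw [covariance_fun_sub_right (hX k) hV (memLp_sum_mul hX a), sub_eq_zero,
      covariance_sum_mul_right hX (hX k)]
    exact (congrFun ha k).symm
  -- Otherwise a functional with coefficients v kills the range but not the vector of covariances.
  -- Then ∑ v_k X_k has variance zero, hence is uncorrelated with V, a contradiction.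
  by_contra hnot
  obtain ⟨f, hfb, hf⟩ := Submodule.exists_le_ker_of_notMem hnot
  set v : Fin p → ℝ := fun k => f fun j => if k = j then 1 else 0
  have hfv (x : Fin p → ℝ) : f x = ∑ k, x k * v k := LinearMap.pi_apply_eq_sum_univ f x
  have hU := memLp_sum_mul hX v
  have hvar : Var[fun ω => ∑ k, v k * X ω k; P] = 0 := by
    have h0 : f ((covarianceMatrix P X).mulVecLin v) = 0 := hf (LinearMap.mem_range_self _ _)
    rw [← covariance_self hU.aemeasurable, covariance_sum_mul_right hX hU, ← h0, hfv]
    refine Finset.sum_congr rfl fun k _ => ?_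
    rw [covariance_comm, covariance_sum_mul_right hX (hX k)]
    rfl
  refine hfb ?_
  rw [hfv, ← covariance_eq_zero_of_variance_eq_zero V hU hvar, covariance_comm,
    covariance_sum_mul_right hX hV]
  exact Finset.sum_congr rfl fun k _ => by rw [covariance_comm]

/-- If `(X, V)` is Gaussian and `V` is almost surely a function of `X`, then this function can be
chosen to be affine. -/
theorem exists_ae_eq_affine_of_ae_eq_comp [IsProbabilityMeasure P] {V : Ω → ℝ}
    (hG : HasGaussianLaw (fun ω => (X ω, V ω)) P) {g : (Fin p → ℝ) → ℝ} (hg : Measurable g)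
    (h : V =ᵐ[P] fun ω => g (X ω)) :
    ∃ (a : Fin p → ℝ) (c : ℝ), V =ᵐ[P] fun ω => c + ∑ k, a k * X ω k := by
  have hXL (k : Fin p) : MemLp (fun ω => X ω k) 2 P := (hG.fst.eval k).memLp_two
  have hVL : MemLp V 2 P := hG.snd.memLp_two
  obtain ⟨a, ha⟩ := exists_covariance_sub_sum_eq_zero hXL hVL
  set R : Ω → ℝ := fun ω => V ω - ∑ k, a k * X ω k with hR
  have hRL : MemLp R 2 P := hVL.sub (memLp_sum_mul hXL a)
  have hGR : HasGaussianLaw (fun ω => (X ω, fun _ : Unit => R ω)) P := by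
    let L : (Fin p → ℝ) × ℝ →L[ℝ] (Fin p → ℝ) × (Unit → ℝ) :=
      (ContinuousLinearMap.fst ℝ _ _).prod (ContinuousLinearMap.pi fun _ =>
        ContinuousLinearMap.snd ℝ _ _ - ∑ k, a k • (ContinuousLinearMap.proj k).comp
          (ContinuousLinearMap.fst ℝ _ _))
    have heq : (fun ω => (X ω, fun _ : Unit => R ω)) = fun ω => L (X ω, V ω) := by
      ext ω <;> simp [L, hR]
    rw [heq]
    exact hG.map_fun L
  have hI : IndepFun X (fun ω (_ : Unit) => R ω) P :=
    HasGaussianLaw.indepFun_of_covariance_eval (X := fun k ω => X ω k) (Y := fun _ => R) hGR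
      fun k _ => ha k
  set g' : (Fin p → ℝ) → ℝ := fun x => g x - ∑ k, a k * x k with hg'
  have hI' : IndepFun (fun ω => g' (X ω)) R P :=
    hI.comp (φ := g') (ψ := fun z : Unit → ℝ => z ()) (by fun_prop) (by fun_prop)
  have hRg : R =ᵐ[P] fun ω => g' (X ω) := by
    filter_upwards [h] with ω hω
    simp [hR, hg', hω]
  -- R is independent of X and a.s. a function of X, so it is uncorrelated with itself.
  have hvar : Var[R; P] = 0 := by
    rw [← covariance_self hRL.aemeasurable, covariance_congr_left hRg]
    exact hI'.covariance_eq_zero (hRL.ae_eq hRg) hRL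
  refine ⟨a, ∫ ω, R ω ∂P, ?_⟩
  filter_upwards [ae_eq_integral_of_variance_eq_zero hRL hvar] with ω hω
  rw [← hω, hR]
  ring

theorem ProbabilityTheory.HasGaussianLaw.volume_absolutelyContinuous_map {V : Ω → ℝ}
    (hV : HasGaussianLaw V P) (hnd : ∀ c, P.map V ≠ Measure.dirac c) : volume ≪ P.map V := by
  rw [hV.map_eq_gaussianReal]
  refine gaussianReal_absolutelyContinuous' _ fun h0 => hnd (∫ ω, V ω ∂P) ?_
  rw [hV.map_eq_gaussianReal, h0, gaussianReal_zero_var]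

end

/-! ### Gaussian characterizations of both extreme cases -/

section
variable {Ω : Type*} [mΩ : MeasurableSpace Ω] {P : Measure Ω} {p q : ℕ}
  {X : Ω → Fin p → ℝ} {Y : Ω → Fin q → ℝ}

theorem ProbabilityTheory.HasGaussianLaw.prodMk_restrict
    (hXY : HasGaussianLaw (fun ω => (X ω, Y ω)) P) (s : Set (Fin q)) [Fintype s] :
    HasGaussianLaw (fun ω => (X ω, fun j : s => Y ω j)) P :=
  let L : (Fin p → ℝ) × (Fin q → ℝ) →L[ℝ] (Fin p → ℝ) × (s → ℝ) :=
    (ContinuousLinearMap.fst ℝ _ _).prod (ContinuousLinearMap.pi fun j : s =>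
      (ContinuousLinearMap.proj (j : Fin q)).comp (ContinuousLinearMap.snd ℝ _ _))
  hXY.map_fun L

theorem ProbabilityTheory.HasGaussianLaw.prodMk_eval
    (hXY : HasGaussianLaw (fun ω => (X ω, Y ω)) P) (i : Fin q) :
    HasGaussianLaw (fun ω => (X ω, Y ω i)) P :=
  hXY.map_fun ((ContinuousLinearMap.fst ℝ (Fin p → ℝ) (Fin q → ℝ)).prod
    ((ContinuousLinearMap.proj i).comp (ContinuousLinearMap.snd ℝ (Fin p → ℝ) (Fin q → ℝ))))

theorem covarianceMatrix_isSymm {ι : Type*} (W : Ω → ι → ℝ) : (covarianceMatrix P W).IsSymm :=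
  Matrix.IsSymm.ext fun _ _ => covariance_comm _ _

variable [IsProbabilityMeasure P]

/-- If the conditional expectation of `V` given a σ-algebra for which `U` is measurable equals that
given a σ-algebra independent of `U`, then `U` and `V` are uncorrelated. -/
theorem covariance_eq_zero_of_condExp_eq {m m' : MeasurableSpace Ω} {U V : Ω → ℝ} (hm : m ≤ mΩ)
    (hm' : m' ≤ mΩ) (hU : StronglyMeasurable[m'] U) (hUL : MemLp U 2 P) (hVL : MemLp V 2 P)
    (hindep : Indep (MeasurableSpace.comap U inferInstance) m P) (h : P[V | m] =ᵐ[P] P[V | m']) :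
    cov[U, V; P] = 0 := by
  have hI : IndepFun U (P[V | m]) P := by
    rw [IndepFun_iff_Indep]
    exact indep_of_indep_of_le_right hindep stronglyMeasurable_condExp.measurable.comap_le
  have hVint := hVL.integrable one_le_two
  have h1 : ∫ ω, (U * V) ω ∂P = ∫ ω, (U * P[V | m]) ω ∂P := by
    rw [← integral_condExp hm' (f := U * V), integral_congr_ae
      (condExp_mul_of_stronglyMeasurable_left hU (hUL.integrable_mul hVL) hVint)]
    refine integral_congr_ae ?_
    filter_upwards [h] with ω hω
    simp [hω]
  rw [covariance_eq_sub hUL hVL, h1, hI.integral_mul_eq_mul_integral hUL.1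
    integrable_condExp.1, integral_condExp hm, sub_self]

theorem covariance_eq_zero_of_integratedVariance_eq (hX : Measurable X) (hY : Measurable Y)
    (hXY : HasGaussianLaw (fun ω => (X ω, Y ω)) P)
    (hnd : ∀ (i : Fin q) (c : ℝ), P.map (fun ω => Y ω i) ≠ Measure.dirac c)
    (h : ∀ i, integratedVariance (pastSigma Y i) P (fun ω => Y ω i) =
      integratedVariance (jointSigma X Y i) P (fun ω => Y ω i)) (i : Fin q) :
    ∀ k, cov[fun ω => X ω k, fun ω => Y ω i; P] = 0 := by
  induction i using WellFoundedLT.induction with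
  | ind i ih =>
    intro k
    have hYi : Measurable fun ω => Y ω i := by fun_prop
    have hYL : MemLp (fun ω => Y ω i) 2 P := (hXY.snd.eval i).memLp_two
    have hle := jointSigma_le hX hY i
    have hE : P[fun ω => Y ω i | pastSigma Y i] =ᵐ[P] P[fun ω => Y ω i | jointSigma X Y i] :=
      condExp_eq_of_ae_condExp_upperIndicator_eq (pastSigma_le_jointSigma i) hle hYi
        (hYL.integrable one_le_two) <|
        ((hXY.snd.eval i).volume_absolutelyContinuous_map (hnd i)).ae_le <|
          ae_condExp_eq_of_integratedVariance_eq (pastSigma_le_jointSigma i) hle hYi (h i)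
    -- By induction X is uncorrelated with the past, and joint Gaussianity upgrades this to
    -- independence.
    have hI : IndepFun X (fun ω (j : Set.Iio i) => Y ω j) P :=
      HasGaussianLaw.indepFun_of_covariance_eval (X := fun k ω => X ω k)
        (Y := fun (j : Set.Iio i) ω => Y ω j) (hXY.prodMk_restrict _) fun k j => ih j j.2 k
    have hIk : IndepFun (fun ω => X ω k) (fun ω (j : Set.Iio i) => Y ω j) P :=
      hI.comp (measurable_pi_apply k) measurable_id
    refine covariance_eq_zero_of_condExp_eq ((pastSigma_le_jointSigma i).trans hle) hle ?_
      (hXY.fst.eval k).memLp_two hYL ((IndepFun_iff_Indep _ _ _).1 hIk) hE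
    have hg : Measurable fun z : (Fin p → ℝ) × (Set.Iio i → ℝ) => z.1 k := by fun_prop
    exact (hg.comp (comap_measurable _)).stronglyMeasurable

theorem integratedVariance_pastSigma_eq (hX : Measurable X) (hY : Measurable Y)
    (hI : IndepFun X Y P) (i : Fin q) :
    integratedVariance (pastSigma Y i) P (fun ω => Y ω i) =
      integratedVariance (jointSigma X Y i) P (fun ω => Y ω i) := by
  rw [jointSigma_eq_sup]
  refine integratedVariance_congr fun y => condExp_sup_of_indep ?_ hX.comap_le hY.comap_le
    ((IndepFun_iff_Indep _ _ _).1 hI) ?_ ?_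
  · have hr : Measurable fun (z : Fin q → ℝ) (j : Set.Iio i) => z j := by fun_prop
    exact (hr.comp (comap_measurable Y)).comap_le
  · have hy : Measurable[MeasurableSpace.comap Y inferInstance] fun ω => Y ω i :=
      (measurable_pi_apply i).comp (comap_measurable Y)
    exact (@measurable_upperIndicator _ (MeasurableSpace.comap Y inferInstance) _
      hy y).stronglyMeasurable
  · exact (memLp_upperIndicator (by fun_prop) y).integrable one_le_two

theorem exists_ae_eq_affine_of_integratedVariance_eq (hX : Measurable X) (hY : Measurable Y)
    (hXY : HasGaussianLaw (fun ω => (X ω, Y ω)) P)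
    (hnd : ∀ (i : Fin q) (c : ℝ), P.map (fun ω => Y ω i) ≠ Measure.dirac c)
    (h : ∀ i, integratedVariance (jointSigma X Y i) P (fun ω => Y ω i) =
      integratedVariance mΩ P (fun ω => Y ω i)) (i : Fin q) :
    ∃ (a : Fin p → ℝ) (c : ℝ), (fun ω => Y ω i) =ᵐ[P] fun ω => c + ∑ k, a k * X ω k := by
  induction i using WellFoundedLT.induction with
  | ind i ih =>
    have hYi : Measurable fun ω => Y ω i := by fun_prop
    have hYint : Integrable (fun ω => Y ω i) P := (hXY.snd.eval i).integrable
    have hle := jointSigma_le hX hY i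
    have hE : P[fun ω => Y ω i | jointSigma X Y i] =ᵐ[P] P[fun ω => Y ω i | mΩ] :=
      condExp_eq_of_ae_condExp_upperIndicator_eq hle le_rfl hYi hYint <|
        ((hXY.snd.eval i).volume_absolutelyContinuous_map (hnd i)).ae_le <|
          ae_condExp_eq_of_integratedVariance_eq hle le_rfl hYi (h i)
    rw [condExp_of_stronglyMeasurable le_rfl hYi.stronglyMeasurable hYint] at hE
    -- Doob–Dynkin: Y_i is a.s. a measurable f of X and the past. Substituting the affine forms of
    -- the past leaves a function of X alone.
    obtain ⟨f, hf, hfe⟩ := (stronglyMeasurable_condExp (μ := P) (m := jointSigma X Y i)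
      (f := fun ω => Y ω i)).measurable.exists_eq_measurable_comp
    choose! a c hac using ih
    refine exists_ae_eq_affine_of_ae_eq_comp (hXY.prodMk_eval i)
      (g := fun x => f (x, fun j : Set.Iio i => c j + ∑ k, a j k * x k)) (by fun_prop) ?_
    have hall : ∀ᵐ ω ∂P, ∀ j : Set.Iio i, Y ω j = c j + ∑ k, a j k * X ω k :=
      ae_all_iff.2 fun j => hac j j.2
    filter_upwards [hE, hall] with ω h1 h2
    rw [← h1, hfe]
    simp only [Function.comp_apply, h2]

theorem integratedVariance_jointSigma_eq (hX : Measurable X) (hY : Measurable Y) {i : Fin q}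
    {a : Fin p → ℝ} {c : ℝ} (h : (fun ω => Y ω i) =ᵐ[P] fun ω => c + ∑ k, a k * X ω k) :
    integratedVariance (jointSigma X Y i) P (fun ω => Y ω i) =
      integratedVariance mΩ P (fun ω => Y ω i) := by
  refine integratedVariance_eq_of_ae_eq (jointSigma_le hX hY i) (by fun_prop) ?_ h
  have hg : Measurable fun z : (Fin p → ℝ) × (Set.Iio i → ℝ) => c + ∑ k, a k * z.1 k := by
    fun_prop
  exact hg.comp (comap_measurable _)

theorem rank_covarianceMatrix_eq_iff
    (hXY : HasGaussianLaw (fun ω => (X ω, Y ω)) P) :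
    (covarianceMatrix P (fun ω => Sum.elim (X ω) (Y ω))).rank =
        (covarianceMatrix P (fun ω => Sum.elim (X ω) (Y ω))).toBlocks₁₁.rank ↔
      ∀ i, ∃ (a : Fin p → ℝ) (c : ℝ), (fun ω => Y ω i) =ᵐ[P] fun ω => c + ∑ k, a k * X ω k := by
  have hXL (k : Fin p) : MemLp (fun ω => X ω k) 2 P := (hXY.fst.eval k).memLp_two
  have hYL (i : Fin q) : MemLp (fun ω => Y ω i) 2 P := (hXY.snd.eval i).memLp_two
  have hWL (s : Fin p ⊕ Fin q) : MemLp (fun ω => Sum.elim (X ω) (Y ω) s) 2 P := by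
    rcases s with k | i
    · exact hXL k
    · exact hYL i
  rw [Matrix.rank_eq_rank_toBlocks₁₁_iff (covarianceMatrix_isSymm _)]
  refine forall_congr' fun i => ⟨?_, ?_⟩
  · rintro ⟨a, ha⟩
    set R : Ω → ℝ := fun ω => Y ω i - ∑ k, a k * X ω k with hR
    have hRL : MemLp R 2 P := (hYL i).sub (memLp_sum_mul hXL a)
    -- The column relation says that R is uncorrelated with every coordinate of X and Y; being a
    -- combination of these, R has variance zero.
    have hcov (s : Fin p ⊕ Fin q) : cov[fun ω => Sum.elim (X ω) (Y ω) s, R; P] = 0 := by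
      rw [covariance_fun_sub_right (hWL s) (hYL i) (memLp_sum_mul hXL a),
        covariance_sum_mul_right hXL (hWL s), sub_eq_zero]
      exact ha s
    have hvar : Var[R; P] = 0 := by
      rw [← covariance_self hRL.aemeasurable]
      nth_rw 1 [hR]
      rw [covariance_fun_sub_left (hYL i) (memLp_sum_mul hXL a) hRL,
        covariance_comm (fun ω => ∑ k, a k * X ω k), covariance_sum_mul_right hXL hRL]
      have h1 : cov[fun ω => Y ω i, R; P] = 0 := hcov (Sum.inr i)
      have h2 (k : Fin p) : cov[R, fun ω => X ω k; P] = 0 := by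
        rw [covariance_comm]
        exact hcov (Sum.inl k)
      simp [h1, h2]
    refine ⟨a, ∫ ω, R ω ∂P, ?_⟩
    filter_upwards [ae_eq_integral_of_variance_eq_zero hRL hvar] with ω hω
    rw [← hω, hR]
    ring
  · rintro ⟨a, c, h⟩
    refine ⟨a, fun s => ?_⟩
    change cov[fun ω => Sum.elim (X ω) (Y ω) s, fun ω => Y ω i; P] =
      ∑ k, cov[fun ω => Sum.elim (X ω) (Y ω) s, fun ω => X ω k; P] * a k
    rw [covariance_congr_right h, covariance_const_add_right
      ((memLp_sum_mul hXL a).integrable one_le_two), covariance_sum_mul_right hXL (hWL s)]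

end

theorem mainTheorem8 {Ω : Type*} [MeasurableSpace Ω] (P : Measure Ω) [IsProbabilityMeasure P]
    (p q : ℕ) (hp : 1 ≤ p) (hq : 1 ≤ q)
    (X : Ω → Fin p → ℝ) (Y : Ω → Fin q → ℝ) (hX : Measurable X) (hY : Measurable Y)
    (hYnd : ∀ (i : Fin q) (c : ℝ), P.map (fun ω => Y ω i) ≠ Measure.dirac c)
    (hXY : HasGaussianLaw (fun ω => (X ω, Y ω)) P)
    (S : Matrix (Fin p ⊕ Fin q) (Fin p ⊕ Fin q) ℝ)
    (hS : S = covarianceMatrix P (fun ω => Sum.elim (X ω) (Y ω))) :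
    (predictabilityT P X Y = 0 ↔ S.toBlocks₁₂ = 0) ∧
      (predictabilityT P X Y = 1 ↔ S.rank = S.toBlocks₁₁.rank) := by
  subst hS
  have hpos (i : Fin q) :=
    integratedVariance_pos (P := P) (V := fun ω => Y ω i) (by fun_prop) (hXY.snd.eval i).integrable
      ((hXY.snd.eval i).volume_absolutelyContinuous_map (hYnd i)) (hYnd i)
  constructor
  · rw [predictabilityT_eq_zero_iff hX hY hpos hq]
    constructor
    · intro h
      ext k i
      exact covariance_eq_zero_of_integratedVariance_eq hX hY hXY hYnd h i k
    · intro h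
      exact integratedVariance_pastSigma_eq hX hY <|
        HasGaussianLaw.indepFun_of_covariance_eval (X := fun k ω => X ω k)
          (Y := fun i ω => Y ω i) hXY fun k i => congrFun (congrFun h k) i
  · rw [predictabilityT_eq_one_iff hX hY hpos hq, rank_covarianceMatrix_eq_iff hXY]
    constructor
    · exact fun h => exists_ae_eq_affine_of_integratedVariance_eq hX hY hXY hYnd h
    · intro h i
      obtain ⟨a, c, hac⟩ := h i
      exact integratedVariance_jointSigma_eq hX hY hac
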